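/- Let $m,n\ge 0$ be integers. Write $\exp_n(\mathbb R^m)$ for the set of all nonempty (closed) subsets of $\mathbb R^m$ with at most $n$ points, with the Vietoris topology, i.e. the topology generated by the sets $\{A: A\subset U\}$ and $\{A: A\cap U\neq\emptyset\}$ with $U$ open in $\mathbb R^m$. For $X\subset\mathbb R^m$, a map $f:X\to\exp_n(\mathbb R^m)$ is fixed-point free if $x\notin f(x)$ for every $x\in X$, and a bright color of $f$ is a closed subset $F$ of $X$ that is disjoint from the closure in $\mathbb R^m$ of $\bigcup_{x\in F} f(x)$. Theorem. For all $m$ and $n$ there is an integer $K(m,n)$, depending only on $m$ and $n$, such that for every closed subspace $X$ of $\mathbb R^m$ and every continuous fixed-point free map $f:X\to\exp_n(\mathbb R^m)$, the space $X$ can be covered by at most $K(m,n)$ bright colors of $f$. -/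

import Mathlib

/-- The hyperspace `2^Z` of all nonempty closed subsets of `Z`. -/
def Hyperspace (Z : Type*) [TopologicalSpace Z] : Type _ :=
  {A : Set Z // A.Nonempty ∧ IsClosed A}

/-- The points of the closed set `A`, as a set in `Z`. -/
def Hyperspace.carrier {Z : Type*} [TopologicalSpace Z] (A : Hyperspace Z) : Set Z :=
  A.1

/-- The Vietoris topology on `2^Z`: it is generated by the sets `{A | A ⊆ U}` and
`{A | A ∩ U ≠ ∅}` with `U` open in `Z`. -/
instance Hyperspace.instTopologicalSpace {Z : Type*} [TopologicalSpace Z] :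
    TopologicalSpace (Hyperspace Z) :=
  TopologicalSpace.induced Hyperspace.carrier (TopologicalSpace.vietoris Z)

/-- The subspace `exp_n(Z)` of `2^Z` of the sets with at most `n` points. -/
abbrev ExpSpace (n : ℕ) (Z : Type*) [TopologicalSpace Z] : Type _ :=
  {A : Hyperspace Z // A.carrier.encard ≤ n}

/-- A multivalued map `f : X → 2^Z`, with `X ⊆ Z`, is fixed-point free if `x ∉ f x` for every
`x ∈ X`. -/
def IsFixedPointFree {Z : Type*} [TopologicalSpace Z] {X : Set Z} (f : X → Hyperspace Z) : Prop :=
  ∀ x : X, (x : Z) ∉ (f x).carrier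

/-- A bright color of `f : X → 2^Z`, with `X ⊆ Z`, is a closed subset `F` of the space `X` that
misses the closure in `Z` of `⋃ {f x | x ∈ F}`. -/
def IsBrightColor {Z : Type*} [TopologicalSpace Z] {X : Set Z} (f : X → Hyperspace Z)
    (F : Set X) : Prop :=
  IsClosed F ∧ Disjoint (Subtype.val '' F) (closure (⋃ x ∈ F, (f x).carrier))

/-- `f : X → 2^Z` is colorable by at most `K` bright colors: some family of at most `K` bright
colors of `f` covers `X`. -/
def IsColorableByBright {Z : Type*} [TopologicalSpace Z] {X : Set Z} (f : X → Hyperspace Z)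
    (K : ℕ) : Prop :=
  ∃ 𝓕 : Finset (Set X), 𝓕.card ≤ K ∧ (∀ F ∈ 𝓕, IsBrightColor f F) ∧
    ∀ x : X, ∃ F ∈ 𝓕, x ∈ F

/-! Cover space by compact sets `C i` with closed neighborhoods `N i`, locally finite and of bounded
multiplicity, so small that `f x` misses `N i` for `x ∈ C i` (`exists_adapted_cover`). Colors will
be unions of pieces of the `C i`, and only edges `i → j`, where `f` sends a point of `C i` into `N
j`, can cause a conflict. An index may have arbitrarily many edges, but a single `f x` has at most
`n` points and meets boundedly many `N j`. So colors are chosen pointwise and each `C i` is cut into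
pieces; greedily along a well-founded relation, boundedly many colors avoid all conflicts with
earlier indices (`exists_greedy_coloring`). Greedy coloring along an enumeration `ρ` settles the
edges going down. The reverse of `ρ` need not be well-founded, but out-degrees are finite by
compactness, so the indices split into finite blocks that an edge going up leaves only for the next
block (`exists_blocks`). A second greedy coloring, against `ρ` inside blocks, and the parity of the
block settle the edges going up. -/

open Set Topology

/-- Every point lies in at most `M` members of the family `N`. -/
def PointMultiplicityLE {ι Z : Type*} (N : ι → Set Z) (M : ℕ) : Prop :=
  ∀ y, ∃ s : Finset ι, s.card ≤ M ∧ ∀ i, y ∈ N i → i ∈ s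

/-- Open covers of compact sets can be refined by finite closed covers that admit closed
neighborhoods of point multiplicity at most `M`. -/
def HasFineCovers (Z : Type*) [TopologicalSpace Z] (M : ℕ) : Prop :=
  ∀ C : Set Z, IsCompact C → ∀ 𝒰 : Set (Set Z), (∀ U ∈ 𝒰, IsOpen U) → C ⊆ ⋃₀ 𝒰 →
    ∃ (κ : Type) (_ : Finite κ) (Q N : κ → Set Z), (∀ z, IsClosed (Q z)) ∧
      (∀ z, IsClosed (N z)) ∧ (∀ z, Q z ⊆ interior (N z)) ∧ C ⊆ ⋃ z, Q z ∧
      PointMultiplicityLE N M ∧ ∀ z, ∃ U ∈ 𝒰, N z ⊆ U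

/-! ### Fine covers of Euclidean spaces -/

/-- Sup-norm balls of radius `s / 2` around the lattice `sℤ^m` tile space. Enlarged to radius `3s /
4 < s`, they contain a given point only if each lattice coordinate is one of two consecutive
integers. -/
theorem Pi.hasFineCovers (m : ℕ) : HasFineCovers (Fin m → ℝ) (2 ^ m) := by
  intro C hC 𝒰 hU hCU
  obtain ⟨δ, hδ, hLeb⟩ := lebesgue_number_lemma_of_metric_sUnion hC hU hCU
  obtain ⟨R, hR⟩ := hC.isBounded.subset_closedBall 0
  -- A ball of radius `3s / 4` whose core meets `C` at `x` stays within `5s / 4 < δ` of `x`.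
  set s : ℝ := δ / 2 with hs
  have hs0 : 0 < s := by positivity
  let c : (Fin m → ℤ) → Fin m → ℝ := fun z i => s * z i
  let B : ℤ := ⌈(R + s) / s⌉
  let κ := {z : Fin m → ℤ // (Metric.closedBall (c z) (s / 2) ∩ C).Nonempty}
  have hfin : Finite κ := by
    refine Set.Finite.to_subtype ((Set.finite_Icc (fun _ => -B) (fun _ => B)).subset ?_)
    rintro z ⟨x, hxz, hxC⟩
    have hxR := hR hxC
    rw [Metric.mem_closedBall] at hxz hxR
    have key : ∀ i, |(z i : ℝ)| ≤ (R + s) / s := by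
      intro i
      have h1 := (dist_le_pi_dist x (c z) i).trans hxz
      have h2 := (dist_le_pi_dist x 0 i).trans hxR
      rw [Real.dist_eq, abs_le] at h1 h2
      simp only [c, Pi.zero_apply] at h1 h2
      rw [le_div_iff₀ hs0, ← abs_of_pos hs0, ← abs_mul, abs_of_pos hs0, abs_le]
      constructor <;> nlinarith [h1.1, h1.2, h2.1, h2.2]
    have hB : (R + s) / s ≤ B := Int.le_ceil _
    constructor <;> intro i
    · have := (abs_le.1 ((key i).trans hB)).1
      exact_mod_cast this
    · have := (abs_le.1 ((key i).trans hB)).2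
      exact_mod_cast this
  refine ⟨κ, hfin, fun z => Metric.closedBall (c z.1) (s / 2),
    fun z => Metric.closedBall (c z.1) (3 * s / 4), fun _ => Metric.isClosed_closedBall,
    fun _ => Metric.isClosed_closedBall, fun z => ?_, ?_, ?_, ?_⟩
  · exact (Metric.closedBall_subset_ball (by linarith)).trans Metric.ball_subset_interior_closedBall
  · intro x hx
    have hmem : x ∈ Metric.closedBall (c fun i => round (x i / s)) (s / 2) := by
      rw [Metric.mem_closedBall, dist_pi_le_iff (by positivity)]
      intro i
      have h := abs_sub_round (x i / s)
      have he : x i - s * round (x i / s) = s * (x i / s - round (x i / s)) := by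
        field_simp
      rw [Real.dist_eq, he, abs_mul, abs_of_pos hs0]
      nlinarith
    exact mem_iUnion.2 ⟨⟨_, x, hmem, hx⟩, hmem⟩
  · intro y
    classical
    let l : Fin m → ℤ := fun i => ⌊y i / s⌋
    refine ⟨(Finset.Icc l (l + 1)).subtype _, ?_, ?_⟩
    · rw [Finset.card_subtype]
      refine (Finset.card_filter_le _ _).trans ?_
      have h2 : ∀ i, (l i + 1 + 1 - l i).toNat = 2 := fun i => by omega
      simp [Pi.card_Icc, h2]
    · rintro ⟨z, hz⟩ hy
      rw [Metric.mem_closedBall] at hy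
      rw [Finset.mem_subtype, Finset.mem_Icc]
      have key : ∀ i, |y i / s - z i| ≤ 3 / 4 := by
        intro i
        have h1 := (dist_le_pi_dist y (c z) i).trans hy
        rw [Real.dist_eq] at h1
        have he : y i - s * z i = s * (y i / s - z i) := by field_simp
        simp only [c] at h1
        rw [he, abs_mul, abs_of_pos hs0] at h1
        nlinarith
      constructor <;> intro i
      · have h1 := (abs_le.1 (key i)).2
        have h2 := Int.floor_le (y i / s)
        have : (l i : ℝ) < z i + 1 := by simp only [l]; linarith
        exact Int.lt_add_one_iff.1 (by exact_mod_cast this)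
      · have h1 := (abs_le.1 (key i)).1
        have h2 := Int.lt_floor_add_one (y i / s)
        have : (z i : ℝ) < l i + 1 + 1 := by simp only [l]; linarith
        exact Int.lt_add_one_iff.1 (by exact_mod_cast this)
  · rintro ⟨z, x, hxz, hxC⟩
    obtain ⟨U, hU, hxU⟩ := hLeb x hxC
    refine ⟨U, hU, fun y hy => hxU ?_⟩
    rw [Metric.mem_closedBall] at hy hxz
    rw [Metric.mem_ball]
    have := dist_triangle_right y x (c z)
    simp only at hy
    linarith

theorem HasFineCovers.of_homeomorph {Y Z : Type*} [TopologicalSpace Y] [TopologicalSpace Z]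
    {M : ℕ} (e : Z ≃ₜ Y) (h : HasFineCovers Y M) : HasFineCovers Z M := by
  intro C hC 𝒰 hU hCU
  obtain ⟨κ, hκ, Q, N, hQ, hN, hQN, hCQ, hM, hNU⟩ := h (e '' C) (hC.image e.continuous)
    ((fun U => e.symm ⁻¹' U) '' 𝒰)
    (by rintro _ ⟨U, hU', rfl⟩; exact (hU U hU').preimage e.symm.continuous)
    (by
      rintro _ ⟨x, hx, rfl⟩
      obtain ⟨U, hU', hxU⟩ := hCU hx
      exact ⟨_, ⟨U, hU', rfl⟩, by simpa using hxU⟩)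
  refine ⟨κ, hκ, fun z => e ⁻¹' Q z, fun z => e ⁻¹' N z, fun z => (hQ z).preimage e.continuous,
    fun z => (hN z).preimage e.continuous, fun z => ?_, ?_, fun y => hM (e y), fun z => ?_⟩
  · rw [← e.preimage_interior]
    exact preimage_mono (hQN z)
  · intro x hx
    simpa using hCQ (mem_image_of_mem e hx)
  · obtain ⟨_, ⟨U, hU', rfl⟩, hNU⟩ := hNU z
    exact ⟨U, hU', fun x hx => by simpa using hNU hx⟩

theorem EuclideanSpace.hasFineCovers (m : ℕ) :
    HasFineCovers (EuclideanSpace ℝ (Fin m)) (2 ^ m) :=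
  (Pi.hasFineCovers m).of_homeomorph (EuclideanSpace.equiv (Fin m) ℝ).toHomeomorph

/-! ### Locally finite covers adapted to a fixed-point free multivalued map -/

/-- Upper semicontinuity of a multivalued map. -/
def UpperSemicontinuousMap {Y Z : Type*} [TopologicalSpace Y] [TopologicalSpace Z]
    (f : Y → Set Z) : Prop :=
  ∀ U, IsOpen U → IsOpen {x | f x ⊆ U}

theorem exists_isOpen_disjoint_image {Z : Type*} [TopologicalSpace Z] [T3Space Z]
    {f : Z → Set Z} (hf : UpperSemicontinuousMap f) {a : Z} (hcl : IsClosed (f a))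
    (ha : a ∉ f a) : ∃ U, IsOpen U ∧ a ∈ U ∧ ∀ x ∈ U, Disjoint (f x) U := by
  obtain ⟨O, O', hO, hO', haO, hfa, hd⟩ := SeparatedNhds.of_isCompact_isClosed
    (isCompact_singleton (x := a)) hcl (disjoint_singleton_left.2 ha)
  exact ⟨O ∩ {x | f x ⊆ O'}, hO.inter (hf O' hO'), ⟨haO rfl, hfa⟩, fun x hx =>
    (hd.symm.mono_left hx.2).mono_right inter_subset_left⟩

/-- The shells of a proper normed group, with closed neighborhoods. -/
theorem exists_shells (Z : Type*) [NormedAddCommGroup Z] [ProperSpace Z] :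
    ∃ A B : ℕ → Set Z, (∀ k, IsCompact (A k)) ∧ (∀ k, IsClosed (B k)) ∧
      (∀ k, A k ⊆ interior (B k)) ∧ (∀ x, ∃ k, x ∈ A k) ∧ LocallyFinite B ∧
      PointMultiplicityLE B 4 := by
  refine ⟨fun k => {x | (k : ℝ) ≤ ‖x‖ ∧ ‖x‖ ≤ k + 1}, fun k => {x | (k : ℝ) - 1 ≤ ‖x‖ ∧ ‖x‖ ≤ k + 2},
    fun k => ?_, fun k => ?_, fun k => ?_, fun x => ?_, fun x => ?_, fun x => ?_⟩
  · refine (isCompact_closedBall (0 : Z) (k + 1)).of_isClosed_subset ?_ ?_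
    · exact (isClosed_le continuous_const continuous_norm).inter
        (isClosed_le continuous_norm continuous_const)
    · intro x hx
      simpa using hx.2
  · exact (isClosed_le continuous_const continuous_norm).inter
        (isClosed_le continuous_norm continuous_const)
  · have ho : IsOpen {x : Z | (k : ℝ) - 1 < ‖x‖ ∧ ‖x‖ < k + 2} :=
      (isOpen_lt continuous_const continuous_norm).inter
        (isOpen_lt continuous_norm continuous_const)
    refine Subset.trans (fun x hx => ?_) (interior_maximal
      (fun x hx => ⟨hx.1.le, hx.2.le⟩ : _ ⊆ {x : Z | (k : ℝ) - 1 ≤ ‖x‖ ∧ ‖x‖ ≤ k + 2}) ho)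
    exact ⟨by linarith [hx.1], by linarith [hx.2]⟩
  · exact ⟨⌊‖x‖⌋₊, Nat.floor_le (norm_nonneg x), (Nat.lt_floor_add_one _).le⟩
  · refine ⟨Metric.ball x 1, Metric.ball_mem_nhds x one_pos,
      (Set.finite_Iic (⌈‖x‖ + 2⌉₊)).subset ?_⟩
    rintro k ⟨y, ⟨hy, -⟩, hyx⟩
    have h1 : ‖y‖ ≤ ‖x‖ + 1 := by
      have := norm_le_norm_add_norm_sub' y x
      rw [mem_ball_iff_norm] at hyx
      linarith
    have h2 := Nat.le_ceil (‖x‖ + 2)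
    have : (k : ℝ) ≤ ⌈‖x‖ + 2⌉₊ := by linarith
    exact_mod_cast this
  · refine ⟨Finset.Ico (⌊‖x‖⌋₊ - 2) (⌊‖x‖⌋₊ + 2), by rw [Nat.card_Ico]; omega, ?_⟩
    rintro k ⟨h1, h2⟩
    have h3 := Nat.floor_le (norm_nonneg x)
    have h4 := Nat.lt_floor_add_one ‖x‖
    have h5 : (k : ℝ) < ⌊‖x‖⌋₊ + 2 := by linarith
    have h6 : (⌊‖x‖⌋₊ : ℝ) ≤ k + 2 := by linarith
    rw [Finset.mem_Ico]
    exact ⟨by have : ⌊‖x‖⌋₊ ≤ k + 2 := by exact_mod_cast h6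
              omega, by exact_mod_cast h5⟩

theorem exists_adapted_cover {Z : Type*} [NormedAddCommGroup Z] [ProperSpace Z] {M : ℕ}
    (hZ : HasFineCovers Z M) {f : Z → Set Z} (hf : UpperSemicontinuousMap f)
    (hcl : ∀ x, IsClosed (f x)) (hfix : ∀ x, x ∉ f x) :
    ∃ (ι : Type) (_ : Countable ι) (C N : ι → Set Z), (∀ i, IsCompact (C i)) ∧
      (∀ i, IsClosed (N i)) ∧ (∀ i, C i ⊆ interior (N i)) ∧ (∀ x, ∃ i, x ∈ C i) ∧
      LocallyFinite N ∧ PointMultiplicityLE N (4 * M) ∧ ∀ i, ∀ x ∈ C i, Disjoint (f x) (N i) := by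
  obtain ⟨A, B, hA, hB, hAB, hcov, hlf, hmult⟩ := exists_shells Z
  have key := fun k => hZ (A k) (hA k) {U | IsOpen U ∧ ∀ x ∈ U, Disjoint (f x) U}
    (fun U hU => hU.1) (fun a _ => by
      obtain ⟨U, hU, haU, hd⟩ := exists_isOpen_disjoint_image hf (hcl a) (hfix a)
      exact ⟨U, ⟨hU, hd⟩, haU⟩)
  choose κ hκ Q N hQ hN hQN hAQ hM hNU using key
  refine ⟨Σ k, κ k, inferInstance, fun i => A i.1 ∩ Q i.1 i.2, fun i => B i.1 ∩ N i.1 i.2,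
    fun i => (hA i.1).inter_right (hQ i.1 i.2), fun i => (hB i.1).inter (hN i.1 i.2),
    fun i => ?_, fun x => ?_, fun x => ?_, fun y => ?_, fun i x hx => ?_⟩
  · rw [interior_inter]
    exact inter_subset_inter (hAB _) (hQN _ _)
  · obtain ⟨k, hk⟩ := hcov x
    obtain ⟨z, hz⟩ := mem_iUnion.1 (hAQ k hk)
    exact ⟨⟨k, z⟩, hk, hz⟩
  · obtain ⟨t, ht, hfin⟩ := hlf x
    refine ⟨t, ht, ?_⟩
    refine (hfin.biUnion (t := fun k => range (Sigma.mk k : κ k → Σ k, κ k))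
      fun k _ => finite_range _).subset ?_
    rintro ⟨k, z⟩ ⟨y, ⟨hy, -⟩, hyt⟩
    exact mem_biUnion (x := k) ⟨y, hy, hyt⟩ ⟨z, rfl⟩
  · obtain ⟨s, hs, hsB⟩ := hmult y
    choose t ht htN using fun k => hM k y
    refine ⟨s.sigma t, ?_, ?_⟩
    · rw [Finset.card_sigma]
      exact (Finset.sum_le_card_nsmul _ _ _ fun k _ => ht k).trans (Nat.mul_le_mul_right _ hs)
    · rintro ⟨k, z⟩ ⟨h1, h2⟩
      exact Finset.mem_sigma.2 ⟨hsB k h1, htN k z h2⟩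
  · obtain ⟨U, ⟨-, hU⟩, hNU⟩ := hNU i.1 i.2
    exact (hU x (hNU (interior_subset (hQN _ _ hx.2)))).mono_right (inter_subset_right.trans hNU)

/-! ### Greedy colorings along a well-founded relation -/

theorem PointMultiplicityLE.image {κ P Z : Type*} {N : κ → Set Z} {M : ℕ}
    (h : PointMultiplicityLE N M) (a : κ → P) (B : Set Z) :
    PointMultiplicityLE (fun p => (⋃ z, ⋃ _ : a z = p, N z) ∩ B) M := by
  classical
  intro y
  obtain ⟨s, hs, hsN⟩ := h y
  refine ⟨s.image a, Finset.card_image_le.trans hs, ?_⟩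
  rintro p ⟨hy, -⟩
  obtain ⟨z, rfl, hz⟩ := mem_iUnion₂.1 hy
  exact Finset.mem_image_of_mem a (hsN z hz)

/-- An open cover of a compact set has a finite closed shrinking with neighborhoods of small
point multiplicity. -/
theorem HasFineCovers.exists_shrinking {Z P : Type*} [TopologicalSpace Z] {M : ℕ}
    (hZ : HasFineCovers Z M) {C B : Set Z} (hC : IsCompact C) (hC' : IsClosed C)
    (hB : IsClosed B) (hCB : C ⊆ interior B) (U : P → Set Z) (hU : ∀ p, IsOpen (U p))
    (hCU : C ⊆ ⋃ p, U p) :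
    ∃ G V : P → Set Z, (∀ p, IsClosed (G p)) ∧ (∀ p, G p ⊆ C) ∧ (∀ p, IsClosed (V p)) ∧
      (∀ p, G p ⊆ interior (V p)) ∧ (∀ p, V p ⊆ B) ∧ PointMultiplicityLE V M ∧
      C ⊆ ⋃ p, G p ∧ ∀ p, G p ⊆ U p := by
  obtain ⟨κ, hκ, Q, N, hQ, hN, hQN, hCQ, hM, hNU⟩ := hZ C hC (range U)
    (by rintro _ ⟨p, rfl⟩; exact hU p) (by rwa [sUnion_range])
  have hNU' : ∀ z, ∃ p, N z ⊆ U p := fun z => by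
    obtain ⟨_, ⟨p, rfl⟩, h⟩ := hNU z
    exact ⟨p, h⟩
  choose a ha using hNU'
  refine ⟨fun p => (⋃ z, ⋃ _ : a z = p, Q z) ∩ C, fun p => (⋃ z, ⋃ _ : a z = p, N z) ∩ B,
    fun p => ?_, fun p => inter_subset_right, fun p => ?_, fun p => ?_,
    fun p => inter_subset_right, hM.image a B, fun x hx => ?_, fun p => ?_⟩
  · exact (isClosed_iUnion_of_finite fun z => isClosed_iUnion_of_finite fun _ => hQ z).inter hC'
  · exact (isClosed_iUnion_of_finite fun z => isClosed_iUnion_of_finite fun _ => hN z).inter hB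
  · rw [interior_inter]
    refine inter_subset_inter (iUnion₂_subset fun z hz => (hQN z).trans ?_) hCB
    exact interior_mono (subset_iUnion₂ (s := fun z (_ : a z = p) => N z) z hz)
  · obtain ⟨z, hz⟩ := mem_iUnion.1 (hCQ hx)
    exact mem_iUnion.2 ⟨a z, mem_iUnion₂.2 ⟨z, rfl, hz⟩, hx⟩
  · rintro x ⟨hx, -⟩
    obtain ⟨z, rfl, hz⟩ := mem_iUnion₂.1 hx
    exact ha z (interior_subset (hQN z hz))

/-- Dependent choice along a well-founded relation. -/
theorem WellFounded.exists_dependent_choice {ι : Type*} {r : ι → ι → Prop} (hr : WellFounded r)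
    {T : Type*} (good : ι → T → Prop) (rel : ι → T → T → Prop)
    (step : ∀ i (prev : ∀ j, r j i → T), (∀ j h, good j (prev j h)) →
      ∃ t, good i t ∧ ∀ j h, rel i (prev j h) t) :
    ∃ φ : ι → T, (∀ i, good i (φ i)) ∧ ∀ i j, r j i → rel i (φ j) (φ i) := by
  let F : ∀ i, (∀ j, r j i → {t // good j t}) → {t // good i t} := fun i prev =>
    ⟨(step i (fun j h => (prev j h).1) fun j h => (prev j h).2).choose,
      (step i (fun j h => (prev j h).1) fun j h => (prev j h).2).choose_spec.1⟩
  refine ⟨fun i => (hr.fix F i).1, fun i => (hr.fix F i).2, fun i j hji => ?_⟩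
  have h := (step i (fun j _ => (hr.fix F j).1) fun j _ => (hr.fix F j).2).choose_spec.2 j hji
  have he : (hr.fix F i).1 =
      (step i (fun j _ => (hr.fix F j).1) fun j _ => (hr.fix F j).2).choose := by
    rw [hr.fix_eq]
  dsimp only
  rwa [he]

/-- Each of the at most `n` points of `A` lies in at most `M` sets `N j`, and for each such `j` in
at most `M'` sets `V j p`: at most `n * (M * M')` colors are spoiled. -/
theorem exists_color_avoiding {ι Z : Type*} {n M M' : ℕ} {N : ι → Set Z}
    (hN : PointMultiplicityLE N M) {D : Set ι}
    {V : D → Fin (n * (M * M') + 1) → Set Z} (hVN : ∀ j p, V j p ⊆ N j)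
    (hV : ∀ j, PointMultiplicityLE (V j) M') {A : Set Z}
    (hA : ∃ t : Finset Z, t.card ≤ n ∧ A ⊆ t) :
    ∃ p, Disjoint A (⋃ j, V j p) := by
  classical
  obtain ⟨t, ht, hAt⟩ := hA
  choose s hs hsN using hN
  choose u hu huV using hV
  let bad : Finset (Fin (n * (M * M') + 1)) :=
    t.biUnion fun y => (s y).biUnion fun i => if h : i ∈ D then u ⟨i, h⟩ y else ∅
  have hbad : bad.card < (Finset.univ : Finset (Fin (n * (M * M') + 1))).card := by
    rw [Finset.card_univ, Fintype.card_fin, Nat.lt_succ_iff]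
    refine (Finset.card_biUnion_le_card_mul _ _ (M * M') fun y _ => ?_).trans
      (Nat.mul_le_mul_right _ ht)
    refine (Finset.card_biUnion_le_card_mul _ _ M' fun i _ => ?_).trans
      (Nat.mul_le_mul_right _ (hs y))
    split_ifs
    · exact hu _ _
    · simp
  obtain ⟨p, -, hp⟩ := Finset.exists_mem_notMem_of_card_lt_card hbad
  refine ⟨p, Set.disjoint_left.2 fun y hyA hy => hp ?_⟩
  obtain ⟨j, hj⟩ := mem_iUnion.1 hy
  refine Finset.mem_biUnion.2 ⟨y, hAt hyA, Finset.mem_biUnion.2 ⟨j, hsN y j (hVN j p hj), ?_⟩⟩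
  rw [dif_pos j.2]
  exact huV j y p hj

theorem exists_greedy_coloring {ι Z : Type*} [TopologicalSpace Z] {n M M' : ℕ}
    (hZ : HasFineCovers Z M') {f : Z → Set Z} (hf : UpperSemicontinuousMap f)
    (hn : ∀ x, ∃ t : Finset Z, t.card ≤ n ∧ f x ⊆ t) {C N : ι → Set Z}
    (hC : ∀ i, IsCompact (C i)) (hC' : ∀ i, IsClosed (C i)) (hN : ∀ i, IsClosed (N i))
    (hCN : ∀ i, C i ⊆ interior (N i)) (hlf : LocallyFinite N) (hM : PointMultiplicityLE N M)
    {r : ι → ι → Prop} (hr : WellFounded r) :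
    ∃ G V : ι → Fin (n * (M * M') + 1) → Set Z, (∀ i p, IsClosed (G i p)) ∧
      (∀ i p, G i p ⊆ C i) ∧ (∀ i p, G i p ⊆ interior (V i p)) ∧ (∀ i, C i ⊆ ⋃ p, G i p) ∧
      ∀ i j, r j i → ∀ p, ∀ x ∈ G i p, Disjoint (f x) (V j p) := by
  let P := Fin (n * (M * M') + 1)
  obtain ⟨φ, hφ, hrel⟩ := hr.exists_dependent_choice (T := (P → Set Z) × (P → Set Z))
    (fun i t => (∀ p, IsClosed (t.1 p)) ∧ (∀ p, t.1 p ⊆ C i) ∧ (∀ p, IsClosed (t.2 p)) ∧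
      (∀ p, t.1 p ⊆ interior (t.2 p)) ∧ (∀ p, t.2 p ⊆ N i) ∧ PointMultiplicityLE t.2 M' ∧
      C i ⊆ ⋃ p, t.1 p)
    (fun _ t t' => ∀ p, ∀ x ∈ t'.1 p, Disjoint (f x) (t.2 p)) (by
      intro i prev hprev
      let D : Set ι := {j | r j i}
      let V : D → P → Set Z := fun j => (prev j.1 j.2).2
      have hVcl : ∀ p, IsClosed (⋃ j, V j p) := fun p =>
        ((hlf.comp_injective Subtype.val_injective).subset
          fun j : D => (hprev j.1 j.2).2.2.2.2.1 p).isClosed_iUnion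
          fun j => (hprev j.1 j.2).2.2.1 p
      obtain ⟨G, W, h1, h2, h3, h4, h5, h6, h7, h8⟩ := hZ.exists_shrinking (hC i) (hC' i) (hN i)
        -- The points at which color `p` is admissible; open, since local finiteness makes the union
        -- closed.
        (hCN i) (fun p => {x | f x ⊆ (⋃ j, V j p)ᶜ}) (fun p => hf _ (hVcl p).isOpen_compl)
        (fun x _ => by
          obtain ⟨p, hp⟩ := exists_color_avoiding hM (V := V)
            (fun j => (hprev j.1 j.2).2.2.2.2.1) (fun j => (hprev j.1 j.2).2.2.2.2.2.1) (hn x)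
          exact mem_iUnion.2 ⟨p, hp.subset_compl_right⟩)
      refine ⟨(G, W), ⟨h1, h2, h3, h4, h5, h6, h7⟩, fun j hj p x hx => ?_⟩
      exact (disjoint_compl_left.mono_left (h8 p hx)).mono_right
        (subset_iUnion (fun j => V j p) ⟨j, hj⟩))
  exact ⟨fun i => (φ i).1, fun i => (φ i).2, fun i => (hφ i).1, fun i => (hφ i).2.1,
    fun i => (hφ i).2.2.2.1, fun i => (hφ i).2.2.2.2.2.2, hrel⟩

/-! ### Digraphs of finite out-degree -/

/-- The `N j` missed by `f x` have closed union, so `f y` misses them all for `y` near `x`;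
compactness does the rest. -/
theorem finite_setOf_image_meets {ι Z : Type*} [TopologicalSpace Z] {f : Z → Set Z}
    (hf : UpperSemicontinuousMap f) (hfin : ∀ x, (f x).Finite) {N : ι → Set Z}
    (hN : ∀ i, IsClosed (N i)) (hlf : LocallyFinite N) {C : Set Z} (hC : IsCompact C) :
    {j | ∃ x ∈ C, ¬ Disjoint (f x) (N j)}.Finite := by
  refine hC.induction_on (p := fun S => {j | ∃ x ∈ S, ¬ Disjoint (f x) (N j)}.Finite) (by simp)
    (fun s t hst ht => ht.subset fun j ⟨x, hx, h⟩ => ⟨x, hst hx, h⟩) (fun s t hs ht => ?_)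
    fun x _ => ?_
  · refine (hs.union ht).subset ?_
    rintro j ⟨x, hx | hx, h⟩
    exacts [Or.inl ⟨x, hx, h⟩, Or.inr ⟨x, hx, h⟩]
  · let J : Set ι := {j | ¬ Disjoint (f x) (N j)}
    have hJ : J.Finite := by
      refine ((hfin x).biUnion fun y _ => hlf.point_finite y).subset fun j hj => ?_
      obtain ⟨y, hy, hyN⟩ := not_disjoint_iff.1 hj
      exact mem_biUnion hy hyN
    have hcl : IsClosed (⋃ j : (Jᶜ : Set ι), N j) :=
      (hlf.comp_injective Subtype.val_injective).isClosed_iUnion fun j => hN j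
    refine ⟨{y | f y ⊆ (⋃ j : (Jᶜ : Set ι), N j)ᶜ},
      mem_nhdsWithin_of_mem_nhds ((hf _ hcl.isOpen_compl).mem_nhds ?_), hJ.subset ?_⟩
    · refine Disjoint.subset_compl_right (disjoint_iUnion_right.2 fun j => ?_)
      exact not_not.1 j.2
    · rintro j ⟨y, hy, hyj⟩
      by_contra hj
      exact hyj ((disjoint_compl_left.mono_left hy).mono_right
        (subset_iUnion (fun j : (Jᶜ : Set ι) => N j) ⟨j, hj⟩))

/-- The vertices of a countable digraph of finite out-degree can be arranged in finite blocks
such that every edge going up stays in its block or leads to the next one. -/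
theorem exists_blocks {ι : Type*} {ρ : ι → ℕ} (hρ : Function.Injective ρ) {E : ι → ι → Prop}
    (hE : ∀ i, {j | E i j}.Finite) :
    ∃ b : ι → ℕ, WellFounded (fun j i => b j = b i ∧ ρ i < ρ j) ∧
      ∀ i j, E i j → ρ i < ρ j → b j = b i ∨ b j = b i + 1 := by
  have hbound : ∀ N : ℕ, ∃ N', N < N' ∧ ∀ i j, ρ i < N → E i j → ρ j < N' := by
    intro N
    have hfin : (⋃ i ∈ {i | ρ i < N}, ρ '' {j | E i j}).Finite :=
      ((Set.finite_Iio N).preimage hρ.injOn).biUnion fun i _ => (hE i).image ρ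
    obtain ⟨B, hB⟩ := hfin.bddAbove
    refine ⟨max B N + 1, by omega, fun i j hi hij => ?_⟩
    have : ρ j ≤ B := hB (mem_biUnion (x := i) hi ⟨j, hij, rfl⟩)
    omega
  choose h hlt hh using hbound
  let t : ℕ → ℕ := fun k => h^[k] 0
  have ht : ∀ k, t (k + 1) = h (t k) := fun k => Function.iterate_succ_apply' h k 0
  have hmono : StrictMono t := strictMono_nat_of_lt_succ fun k => by rw [ht]; exact hlt _
  have hex : ∀ i, ∃ k, ρ i < t k := fun i => ⟨ρ i + 1, (Nat.lt_succ_self _).trans_le hmono.le_apply⟩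
  classical
  refine ⟨fun i => Nat.find (hex i), ?_, fun i j hij hlt => ?_⟩
  -- Inside block `k` the values of `ρ` are bounded by `t k`, so ascents terminate.
  · refine Subrelation.wf ?_ (measure fun i => t (Nat.find (hex i)) - ρ i).wf
    rintro j i ⟨hb, hlt⟩
    have h1 := Nat.find_spec (hex j)
    change t (Nat.find (hex j)) - ρ j < t (Nat.find (hex i)) - ρ i
    dsimp only at hb
    rw [← hb]
    omega
  · have h1 : Nat.find (hex i) ≤ Nat.find (hex j) :=
      Nat.find_min' _ (hlt.trans (Nat.find_spec (hex j)))
    have h2 : Nat.find (hex j) ≤ Nat.find (hex i) + 1 := by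
      refine Nat.find_min' _ ?_
      rw [ht]
      exact hh _ _ _ (Nat.find_spec (hex i)) hij
    dsimp only
    omega

/-! ### Colorings of fixed-point free maps -/

/-- A covering by closed sets, each of which is disjoint from the closure of its image. -/
def HasBrightCovering {Z : Type*} [TopologicalSpace Z] (f : Z → Set Z) (P : Type*) : Prop :=
  ∃ F : P → Set Z, (∀ p, IsClosed (F p)) ∧ (∀ p, Disjoint (F p) (closure (⋃ x ∈ F p, f x))) ∧
    ∀ x, ∃ p, x ∈ F p

theorem hasBrightCovering_of_fixedPointFree {Z : Type*} [NormedAddCommGroup Z] [ProperSpace Z]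
    {n M : ℕ} (hZ : HasFineCovers Z M) {f : Z → Set Z} (hf : UpperSemicontinuousMap f)
    (hn : ∀ x, ∃ t : Finset Z, t.card ≤ n ∧ f x ⊆ t) (hfix : ∀ x, x ∉ f x) :
    HasBrightCovering f
      (Fin (n * (4 * M * M) + 1) × Fin (n * (4 * M * M) + 1) × Fin 2) := by
  have hfin : ∀ x, (f x).Finite := fun x => by
    obtain ⟨t, -, ht⟩ := hn x
    exact t.finite_toSet.subset ht
  obtain ⟨ι, _, C, N, hC, hN, hCN, hcov, hlf, hM, hd⟩ :=
    exists_adapted_cover hZ hf (fun x => (hfin x).isClosed) hfix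
  obtain ⟨ρ, hρ⟩ := exists_injective_nat ι
  obtain ⟨b, hb, hbE⟩ := exists_blocks hρ
    (E := fun i j => ∃ x ∈ C i, ¬ Disjoint (f x) (N j))
    fun i => finite_setOf_image_meets hf hfin hN hlf (hC i)
  have hC' := fun i => (hC i).isClosed
  obtain ⟨G, V, hG, hGC, hGV, hCG, hGd⟩ := exists_greedy_coloring hZ hf hn hC hC' hN hCN hlf hM
    (measure ρ).wf
  obtain ⟨G', V', hG', -, hGV', hCG', hGd'⟩ := exists_greedy_coloring hZ hf hn hC hC' hN hCN hlf
    hM hb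
  have hCN' : ∀ i, C i ⊆ N i := fun i => (hCN i).trans interior_subset
  refine ⟨fun c => ⋃ i : {i // b i % 2 = c.2.2}, G i c.1 ∩ G' i c.2.1, fun c => ?_, ?_, ?_⟩
  · exact ((hlf.comp_injective Subtype.val_injective).subset fun i =>
      inter_subset_left.trans ((hGC _ _).trans (hCN' _))).isClosed_iUnion
      fun i => (hG _ _).inter (hG' _ _)
  · rintro ⟨p, q, e⟩
    refine Set.disjoint_left.2 fun y hy hycl => ?_
    obtain ⟨⟨j, hj⟩, hyG, hyG'⟩ := mem_iUnion.1 hy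
    -- The closure forces the use of neighborhoods: the point `w` of `f x` is only near the piece of
    -- `C j` containing `y`.
    obtain ⟨w, ⟨⟨hwV, hwV'⟩, hwN⟩, hw⟩ := mem_closure_iff.1 hycl
      (interior (V j p) ∩ interior (V' j q) ∩ interior (N j))
      ((isOpen_interior.inter isOpen_interior).inter isOpen_interior)
      ⟨⟨hGV _ _ hyG, hGV' _ _ hyG'⟩, hCN _ (hGC _ _ hyG)⟩
    obtain ⟨x, hx, hwx⟩ := mem_iUnion₂.1 hw
    obtain ⟨⟨i, hi⟩, hxG, hxG'⟩ := mem_iUnion.1 hx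
    have hxC := hGC _ _ hxG
    have hmeet : ∀ {S : Set Z}, w ∈ interior S → ¬ Disjoint (f x) S := fun hS =>
      not_disjoint_iff.2 ⟨w, hwx, interior_subset hS⟩
    rcases lt_trichotomy (ρ j) (ρ i) with hlt | heq | hlt
    · exact hmeet hwV (hGd i j hlt p x hxG)
    · obtain rfl := hρ heq
      exact hmeet hwN (hd _ x hxC)
    · rcases hbE i j ⟨x, hxC, hmeet hwN⟩ hlt with h | h
      · exact hmeet hwV' (hGd' i j ⟨h, hlt⟩ q x hxG')
      · dsimp only at hi hj
        omega
  · intro x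
    obtain ⟨i, hi⟩ := hcov x
    obtain ⟨p, hp⟩ := mem_iUnion.1 (hCG i hi)
    obtain ⟨q, hq⟩ := mem_iUnion.1 (hCG' i hi)
    exact ⟨(p, q, ⟨b i % 2, Nat.mod_lt _ two_pos⟩), mem_iUnion.2 ⟨⟨i, rfl⟩, hp, hq⟩⟩

/-! ### Maps defined on closed subsets -/

/-- The extension of a set-valued map on `X` by the empty set. -/
def extendByEmpty {Z : Type*} [TopologicalSpace Z] {X : Set Z} (f : X → Hyperspace Z) (x : Z) :
    Set Z :=
  {y | ∃ h : x ∈ X, y ∈ (f ⟨x, h⟩).carrier}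

theorem extendByEmpty_coe {Z : Type*} [TopologicalSpace Z] {X : Set Z} (f : X → Hyperspace Z)
    (x : X) : extendByEmpty f x = (f x).carrier := by
  ext y
  exact ⟨fun ⟨_, h⟩ => h, fun h => ⟨x.2, h⟩⟩

theorem extendByEmpty_of_notMem {Z : Type*} [TopologicalSpace Z] {X : Set Z}
    (f : X → Hyperspace Z) {x : Z} (hx : x ∉ X) : extendByEmpty f x = ∅ :=
  eq_empty_of_forall_notMem fun _ ⟨h, _⟩ => hx h

/-- The empty value lies in every `U`, so the extension only adds the open set `Xᶜ`. -/
theorem upperSemicontinuousMap_extendByEmpty {Z : Type*} [TopologicalSpace Z] {X : Set Z}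
    (hX : IsClosed X) {f : X → Hyperspace Z} (hf : Continuous f) :
    UpperSemicontinuousMap (extendByEmpty f) := by
  intro U hU
  have hopen : IsOpen {x : X | (f x).carrier ⊆ U} := by
    let _ := TopologicalSpace.vietoris Z
    have hc : Continuous (Hyperspace.carrier : Hyperspace Z → Set Z) := continuous_induced_dom
    exact hU.powerset_vietoris.preimage (hc.comp hf)
  obtain ⟨O, hO, hOX⟩ := isOpen_induced_iff.1 hopen
  convert hO.union hX.isOpen_compl using 1
  ext x
  by_cases hx : x ∈ X
  · have h1 : x ∈ O ↔ (f ⟨x, hx⟩).carrier ⊆ U := Set.ext_iff.1 hOX ⟨x, hx⟩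
    simp [h1, hx, ← extendByEmpty_coe]
  · simp [extendByEmpty_of_notMem f hx, hx]

theorem HasBrightCovering.isColorableByBright {Z : Type*} [TopologicalSpace Z] {X : Set Z}
    {f : X → Hyperspace Z} {P : Type*} [Fintype P]
    (h : HasBrightCovering (extendByEmpty f) P) : IsColorableByBright f (Fintype.card P) := by
  classical
  obtain ⟨F, hF, hd, hcov⟩ := h
  refine ⟨Finset.univ.image fun p => Subtype.val ⁻¹' F p, Finset.card_image_le, ?_, fun x => ?_⟩
  · intro S hS
    obtain ⟨p, -, rfl⟩ := Finset.mem_image.1 hS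
    refine ⟨(hF p).preimage continuous_subtype_val, (hd p).mono (image_preimage_subset _ _)
      (closure_mono (iUnion₂_subset fun x hx => ?_))⟩
    rw [← extendByEmpty_coe]
    exact subset_iUnion₂ (s := fun x (_ : x ∈ F p) => extendByEmpty f x) (x : Z) hx
  · obtain ⟨p, hp⟩ := hcov x
    exact ⟨_, Finset.mem_image_of_mem _ (Finset.mem_univ p), hp⟩

theorem theorem2 (m n : ℕ) :
    ∃ K : ℕ, ∀ (X : Set (EuclideanSpace ℝ (Fin m))), IsClosed X →
      ∀ f : X → ExpSpace n (EuclideanSpace ℝ (Fin m)), Continuous f →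
        IsFixedPointFree (fun x => (f x).1) →
          IsColorableByBright (fun x => (f x).1) K := by
  -- Unification gives `K = 2 (n 4^(m+1) + 1)^2`, up to arithmetic.
  refine ⟨_, fun X hX f hf hfix => (hasBrightCovering_of_fixedPointFree (n := n)
    (EuclideanSpace.hasFineCovers m)
    (upperSemicontinuousMap_extendByEmpty hX (continuous_subtype_val.comp hf)) (fun x => ?_)
    fun x => ?_).isColorableByBright⟩
  · by_cases hx : x ∈ X
    · obtain ⟨t, ht⟩ := (finite_of_encard_le_coe (f ⟨x, hx⟩).2).exists_finset_coe
      refine ⟨t, ?_, ?_⟩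
      · have := (f ⟨x, hx⟩).2
        rw [← ht, encard_coe_eq_coe_finsetCard] at this
        exact_mod_cast this
      · rw [ht]
        rintro y ⟨_, hy⟩
        exact hy
    · exact ⟨∅, by simp, by
        rintro y ⟨h, -⟩
        exact absurd h hx⟩
  · rintro ⟨h, hx⟩
    exact hfix ⟨x, h⟩ hx
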